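/- Let $R$ be a commutative ring, $n\ge 0$, and let $\mathcal C$ be a disk-like $n$-category enriched in chain complexes of $R$-modules (ordinary, i.e. with $n$-morphisms in $R$-modules placed in degree $0$, or $A_\infty$). Only the following part of the structure of $\mathcal C$ is used: functors $\mathcal C_k$ from $k$-balls and homeomorphisms to sets for $k<n$; natural boundary maps $\partial:\mathcal C_k(X)\to\underline{\mathcal C}_{k-1}(\partial X)$, where $\underline{\mathcal C}_{k-1}$ is the extension of $\mathcal C_{k-1}$ to $(k-1)$-manifolds by colimits over permissible decompositions; chain complexes $\mathcal C_n(X;c)$ for $n$-balls $X$ and $c\in\underline{\mathcal C}_{n-1}(\partial X)$, on which homeomorphisms act functorially; and gluing maps for $B=B_1\cup_Y B_2$ ($Y$ a ball), natural under homeomorphisms, compatible with boundaries, injective for $k<n$, and strictly associative. Product morphisms, isotopy invariance and the action of families of homeomorphisms are not needed. For a topological $n$-manifold $W$ (possibly with boundary), a permissible decomposition of $W$ is a map $x:\bigsqcup_a X_a\to W$ from a finite disjoint union of $n$-balls which is the composite of a sequence of gluings of $n$-manifolds $\bigsqcup_a X_a=M_0\to\cdots\to M_m=W$. Write $x\le y$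 if $y=\{Y_b\}$ is obtained from $x$ by a sequence of gluings of balls to balls, and let $\mathfrak D(W)$ be the resulting (pre)ordered set. Let $\psi_{\mathcal C;W}(x)=\bigoplus_{\beta}\bigotimes_a \mathcal C_n(X_a;\beta_a)$, where $\beta=(\beta_a)$ runs over the families of boundary values $\beta_a\in\underline{\mathcal C}_{n-1}(\partial X_a)$ which split along the decomposition and whose restrictions to shared pieces of boundary agree; the gluing maps make $\psi_{\mathcal C;W}$ a functor on $\mathfrak D(W)$. The blob complex $\mathcal B_*(W;\mathcal C)$ is its homotopy colimit $$\mathcal B_*(W;\mathcal C)=\bigoplus_{m\ge0}\ \bigoplus_{\bar x=(x_0\le\cdots\le x_m)}\psi_{\mathcal C;W}(x_0)[m],$$ $$\partial(\bar x,a)=(\bar x,\partial a)+(-1)^{\deg a}\Big((d_0\bar x,g(a))+\sum_{i=1}^m(-1)^i(d_i\bar x,a)\Big),$$ with $g:\psi_{\mathcal C;W}(x_0)\to\psi_{\mathcal C;W}(x_1)$ the gluing map. Then $W\mapsto\mathcal B_*(W;\mathcal C)$ is a functor from the category of $n$-manifolds and homeomorphisms to the category of chain complexes of $R$-modules and isomorphisms,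 where a homeomorphism $f:W\to W'$ sends $(\bar x,a)$ to $(f\circ\bar x,a)$; here $f\circ\bar x$ is the simplex of decompositions $\bigsqcup_a X_a\to W\xrightarrow{f}W'$, formed from the same balls. In particular, $f\mapsto\mathcal B_*(f)$ is an action of the group $\mathrm{Homeo}(W)$ on the chain complex $\mathcal B_*(W;\mathcal C)$ by automorphisms, for every $n$-manifold $W$. -/

import Mathlib

open CategoryTheory CategoryTheory.Limits MonoidalCategory

universe u w w' v

noncomputable section

namespace Blob

/-! ### Manifolds, balls and gluings -/

/-- The closed half space `{x₀ ≥ 0}` of `ℝᵏ` (a point for `k = 0`). -/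
abbrev HalfSpace (k : ℕ) : Type :=
  {x : EuclideanSpace ℝ (Fin k) // ∀ i : Fin k, i.val = 0 → 0 ≤ x i}

/-- Topological `k`-manifolds, possibly with boundary. -/
structure IsMfd (k : ℕ) (M : Type u) [TopologicalSpace M] : Prop where
  t2 : T2Space M
  secondCountable : SecondCountableTopology M
  chart : ∀ x : M, ∃ φ : OpenPartialHomeomorph M (HalfSpace k), x ∈ φ.source

/-- The boundary of a `k`-manifold: the points without a neighbourhood homeomorphic to an open
subset of `ℝᵏ`. -/
def bdry (k : ℕ) (M : Type u) [TopologicalSpace M] : Set M :=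
  {x | ¬ ∃ φ : OpenPartialHomeomorph M (EuclideanSpace ℝ (Fin k)), x ∈ φ.source}

/-- A `k`-ball: a space homeomorphic to the standard closed `k`-ball. -/
structure Ball (k : ℕ) where
  carrier : TopCat.{u}
  isBall : Nonempty (carrier ≃ₜ Metric.closedBall (0 : EuclideanSpace ℝ (Fin k)) 1)

instance (k : ℕ) : CoeSort (Ball.{u} k) (Type u) := ⟨fun X => X.carrier⟩

/-- A gluing `M → M'` of `k`-manifolds: `M'` is the quotient of `M` which identifies two disjoint
codimension `0` submanifolds `Y`, `Y'` of `∂M` along a homeomorphism. -/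
structure Gluing (k : ℕ) (M M' : Type u) [TopologicalSpace M] [TopologicalSpace M'] where
  map : M → M'
  Y : Set M
  Y' : Set M
  φ : Y ≃ₜ Y'
  mfd : IsMfd k M
  mfd' : IsMfd k M'
  isClosed_Y : IsClosed Y
  isClosed_Y' : IsClosed Y'
  Y_sub : Y ⊆ bdry k M
  Y'_sub : Y' ⊆ bdry k M
  disj : Disjoint Y Y'
  mfd_Y : IsMfd (k - 1) Y
  mfd_compl : IsMfd (k - 1) (closure (bdry k M \ (Y ∪ Y')))
  quot : Topology.IsQuotientMap map
  map_eq_iff : ∀ p q : M, map p = map q ↔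
    p = q ∨ (∃ y : Y, p = y ∧ q = φ y) ∨ (∃ y : Y, q = y ∧ p = φ y)

/-- `B = B₁ ∪_Y B₂`, where `B₁`, `B₂`, `B` are `k`-balls and `Y` is a `(k-1)`-ball in the boundary
of both `B₁` and `B₂`. -/
structure BallGluing (k : ℕ) (B₁ B₂ B : Ball.{u} k) extends Gluing k (B₁ ⊕ B₂) B where
  pos : 0 < k
  Y_left : Y ⊆ Set.range Sum.inl
  Y'_right : Y' ⊆ Set.range Sum.inr
  isBall_Y : Nonempty (Y ≃ₜ Metric.closedBall (0 : EuclideanSpace ℝ (Fin (k - 1))) 1)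

/-- The disjoint union of a finite list of balls. -/
def Total {k : ℕ} : List (Ball.{u} k) → TopCat.{u}
  | [] => TopCat.of PEmpty
  | X :: l => TopCat.of (X ⊕ Total l)

/-- `Assembles k W M f`: there is a sequence of gluings `M = M₀ → M₁ → ⋯ → M_m = W` of
`k`-manifolds with composite `f`. -/
inductive Assembles (k : ℕ) (W : Type u) [TopologicalSpace W] : (M : TopCat.{u}) → (M → W) → Prop
  | homeo {M : TopCat.{u}} (e : M ≃ₜ W) : Assembles k W M e
  | glue {M M' : TopCat.{u}} (G : Gluing k M M') {h : M' → W} (s : Assembles k W M' h) :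
      Assembles k W M (h ∘ G.map)

/-- A permissible decomposition of `W`: a map `⊔ X_a → W` from a finite disjoint union of balls
which can be completed to a ball decomposition `⊔ X_a = M₀ → ⋯ → M_m = W`. -/
structure Decomp (k : ℕ) (W : Type u) [TopologicalSpace W] where
  shape : List (Ball.{u} k)
  map : Total shape → W
  permissible : Assembles k W (Total shape) map

/-- One step `M_j → M_{j+1}` between disjoint unions of balls: a homeomorphism of one ball, an
exchange of two summands, or the gluing of two of the balls to one ball. -/
inductive Step {k : ℕ} : List (Ball.{u} k) → List (Ball.{u} k) → Type (u + 1)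
  | homeo {X X' : Ball.{u} k} (e : X ≃ₜ X') (l : List (Ball.{u} k)) : Step (X :: l) (X' :: l)
  | swap (X X' : Ball.{u} k) (l : List (Ball.{u} k)) : Step (X :: X' :: l) (X' :: X :: l)
  | glue {B₁ B₂ B : Ball.{u} k} (G : BallGluing k B₁ B₂ B) (l : List (Ball.{u} k)) :
      Step (B₁ :: B₂ :: l) (B :: l)
  | cons (X : Ball.{u} k) {l l' : List (Ball.{u} k)} (s : Step l l') : Step (X :: l) (X :: l')

/-- The map of spaces underlying a step. -/
def Step.map {k : ℕ} : {l l' : List (Ball.{u} k)} → Step l l' → Total l → Total l'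
  | _, _, .homeo e _ => Sum.map e id
  | _, _, .swap _ _ _ =>
      Sum.elim (Sum.inr ∘ Sum.inl) (Sum.elim Sum.inl (Sum.inr ∘ Sum.inr))
  | _, _, .glue G _ =>
      Sum.elim (Sum.inl ∘ G.map ∘ Sum.inl) (Sum.elim (Sum.inl ∘ G.map ∘ Sum.inr) Sum.inr)
  | _, _, .cons _ s => Sum.map id s.map

/-- A sequence of gluings all of whose terms are disjoint unions of balls. -/
inductive Chain {k : ℕ} : List (Ball.{u} k) → List (Ball.{u} k) → Type (u + 1)
  | nil (l : List (Ball.{u} k)) : Chain l l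
  | cons {l l' l'' : List (Ball.{u} k)} (s : Step l l') (t : Chain l' l'') : Chain l l''

/-- The composite of the gluings of a chain. -/
def Chain.map {k : ℕ} : {l l' : List (Ball.{u} k)} → Chain l l' → Total l → Total l'
  | _, _, .nil _ => id
  | _, _, .cons s t => t.map ∘ s.map

def Chain.append {k : ℕ} : {l l' l'' : List (Ball.{u} k)} → Chain l l' → Chain l' l'' → Chain l l''
  | _, _, _, .nil _, t' => t'
  | _, _, _, .cons s t, t' => .cons s (t.append t')

lemma Chain.map_append {k : ℕ} {l l' l'' : List (Ball.{u} k)} (t : Chain l l')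
    (t' : Chain l' l'') : (t.append t').map = t'.map ∘ t.map := by
  induction t with
  | nil => rfl
  | cons s t ih => simp only [append, map, ih]; rfl

/-- The poset of permissible decompositions: `x ≤ y` if `x` is a refinement of `y`, that is, if
`y` is obtained from `x` by a sequence of gluings through disjoint unions of balls (followed by
the gluings which assemble `W` from `y`). -/
instance (k : ℕ) (W : Type u) [TopologicalSpace W] : Preorder (Decomp k W) where
  le x y := ∃ t : Chain x.shape y.shape, x.map = y.map ∘ t.map
  le_refl x := ⟨.nil _, rfl⟩
  le_trans x y z := by
    rintro ⟨t, ht⟩ ⟨t', ht'⟩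
    exact ⟨t.append t', by rw [Chain.map_append, ht, ht']; rfl⟩

/-! ### Labelled decompositions -/

/-- A functor from the category of `k`-balls and homeomorphisms to sets. -/
structure Labels (k : ℕ) where
  obj : Ball.{u} k → Type w
  map : ∀ {X X' : Ball.{u} k}, (X ≃ₜ X') → obj X → obj X'
  map_refl : ∀ (X : Ball.{u} k) (c : obj X), map (Homeomorph.refl X) c = c
  map_trans : ∀ {X X' X'' : Ball.{u} k} (e : X ≃ₜ X') (e' : X' ≃ₜ X'') (c : obj X),
    map (e.trans e') c = map e' (map e c)

/-- The product `∏_a C(X_a)`. -/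
def Lbl {k : ℕ} (F : Labels.{u, w} k) : List (Ball.{u} k) → Type w
  | [] => PUnit
  | X :: l => F.obj X × Lbl F l

/-- A finite family of labelled balls mapped to `M`. -/
structure LDec {k : ℕ} (F : Labels.{u, w} k) (M : Type u) where
  shape : List (Ball.{u} k)
  map : Total shape → M
  lab : Lbl F shape

/-- A single labelled ball mapped to `M`. -/
structure Piece {k : ℕ} (F : Labels.{u, w} k) (M : Type u) where
  ball : Ball.{u} k
  map : ball → M
  lab : F.obj ball

/-- Two labelled pieces which agree up to a reparametrization of the ball. -/
def Piece.Same {k : ℕ} {F : Labels.{u, w} k} {M : Type u} (p q : Piece F M) : Prop :=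
  ∃ e : p.ball ≃ₜ q.ball, p.map = q.map ∘ e ∧ q.lab = F.map e p.lab

def Piece.push {k : ℕ} {F : Labels.{u, w} k} {M M' : Type u} (g : M → M') (p : Piece F M) :
    Piece F M' := ⟨p.ball, g ∘ p.map, p.lab⟩

def LDec.push {k : ℕ} {F : Labels.{u, w} k} {M M' : Type u} (g : M → M') (L : LDec F M) :
    LDec F M' := ⟨L.shape, g ∘ L.map, L.lab⟩

def piecesAux {k : ℕ} {F : Labels.{u, w} k} {M : Type u} :
    (l : List (Ball.{u} k)) → (Total l → M) → Lbl F l → List (Piece F M)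
  | [], _, _ => []
  | X :: l, f, c => ⟨X, f ∘ Sum.inl, c.1⟩ :: piecesAux l (f ∘ Sum.inr) c.2

/-- The list of the labelled pieces of a labelled decomposition. -/
def LDec.pieces {k : ℕ} {F : Labels.{u, w} k} {M : Type u} (L : LDec F M) : List (Piece F M) :=
  piecesAux L.shape L.map L.lab

/-- The data from which fields on `k`-manifolds are built: labels for `k`-balls, their
boundary values, and composition. `bd X c L` says that the boundary value of `c` is represented
by the labelled decomposition `L` of the sphere `∂X` into `(k-1)`-balls. The value of `gl` matters
only on pairs whose restrictions to the common boundary piece agree. -/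
structure System (k : ℕ) (A : Labels.{u, w} (k - 1)) extends Labels.{u, w'} k where
  bd : ∀ X : Ball.{u} k, obj X → LDec A (bdry k X) → Prop
  gl : ∀ {B₁ B₂ B : Ball.{u} k}, BallGluing k B₁ B₂ B → obj B₁ → obj B₂ → obj B

namespace System

variable {k : ℕ} {A : Labels.{u, w} (k - 1)} (S : System.{u, w, w'} k A)

/-- Transport of labels along a step, by homeomorphisms and composition. -/
def stepAct : {l l' : List (Ball.{u} k)} → Step l l' → Lbl S.toLabels l → Lbl S.toLabels l'
  | _, _, .homeo e _, c => (S.map e c.1, c.2)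
  | _, _, .swap _ _ _, c => (c.2.1, c.1, c.2.2)
  | _, _, .glue G _, c => (S.gl G c.1 c.2.1, c.2.2)
  | _, _, .cons _ s, c => (c.1, stepAct s c.2)

def act : {l l' : List (Ball.{u} k)} → Chain l l' → Lbl S.toLabels l → Lbl S.toLabels l'
  | _, _, .nil _, c => c
  | _, _, .cons s t, c => act t (S.stepAct s c)

lemma act_append {l l' l'' : List (Ball.{u} k)} (t : Chain l l') (t' : Chain l' l'')
    (c : Lbl S.toLabels l) : S.act (t.append t') c = S.act t' (S.act t c) := by
  induction t with
  | nil => rfl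
  | cons s t ih => exact ih _ _

/-- `ps` is the list of all pieces, mapped to `W`, of some decompositions of the spheres `∂X_a`
along which the boundary values of the labels `c_a` split. -/
def BdPieces {W : Type u} :
    (l : List (Ball.{u} k)) → (Total l → W) → Lbl S.toLabels l → List (Piece A W) → Prop
  | [], _, _, ps => ps = []
  | X :: l, f, c, ps => ∃ (L : LDec A (bdry k X)) (ps' : List (Piece A W)), S.bd X c.1 L ∧
      BdPieces l (f ∘ Sum.inr) c.2 ps' ∧
      ps = (L.push (fun z => f (Sum.inl z.1))).pieces ++ ps'

/-- The boundary values of the labels `c_a` split along decompositions of the spheres `∂X_a`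
such that the pieces which are glued to each other in `W` carry the same label; the pieces which
are not glued form the decomposition `L` of `∂W`. -/
def MatchBd {W : Type u} [TopologicalSpace W] {l : List (Ball.{u} k)} (f : Total l → W)
    (c : Lbl S.toLabels l) (L : LDec A (bdry k W)) : Prop :=
  Assembles (k - 1) (bdry k W) (Total L.shape) L.map ∧
  ∃ ps P P' : List (Piece A W), S.BdPieces l f c ps ∧ List.Forall₂ Piece.Same P P' ∧
    ps.Perm (P ++ P' ++ (L.push Subtype.val).pieces)

/-- The restrictions of the `c_a` to the various pieces of shared boundaries all agree. -/
def Match {W : Type u} [TopologicalSpace W] {l : List (Ball.{u} k)} (f : Total l → W)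
    (c : Lbl S.toLabels l) : Prop := ∃ L, S.MatchBd f c L

/-- The map `B₁ ⊔ B₂ → B` of a gluing of balls, as a decomposition of `B`. -/
def pairMap {B₁ B₂ B : Ball.{u} k} (G : BallGluing k B₁ B₂ B) : Total [B₁, B₂] → B :=
  Sum.elim (G.map ∘ Sum.inl) (Sum.elim (G.map ∘ Sum.inr) PEmpty.elim)

def pairLbl {B₁ B₂ : Ball.{u} k} (c₁ : S.obj B₁) (c₂ : S.obj B₂) : Lbl S.toLabels [B₁, B₂] :=
  (c₁, c₂, PUnit.unit)

/-- `(c₁, c₂)` lies in the fibered product `C(B₁)_E ×_{C(Y)} C(B₂)_E`. -/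
def Composable {B₁ B₂ B : Ball.{u} k} (G : BallGluing k B₁ B₂ B) (c₁ : S.obj B₁)
    (c₂ : S.obj B₂) : Prop := S.Match (pairMap G) (S.pairLbl c₁ c₂)

/-- The composition required by a step is defined on `c`. -/
def stepOk : {l l' : List (Ball.{u} k)} → Step l l' → Lbl S.toLabels l → Prop
  | _, _, .homeo _ _, _ => True
  | _, _, .swap _ _ _, _ => True
  | _, _, .glue G _, c => S.Composable G c.1 c.2.1
  | _, _, .cons _ s, c => stepOk s c.2

def ok : {l l' : List (Ball.{u} k)} → Chain l l' → Lbl S.toLabels l → Prop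
  | _, _, .nil _, _ => True
  | _, _, .cons s t, c => S.stepOk s c ∧ ok t (S.stepAct s c)

lemma ok_append {l l' l'' : List (Ball.{u} k)} (t : Chain l l') (t' : Chain l' l'')
    (c : Lbl S.toLabels l) : S.ok (t.append t') c ↔ S.ok t c ∧ S.ok t' (S.act t c) := by
  induction t with
  | nil => simp [Chain.append, ok, act]
  | cons s t ih => simp only [Chain.append, ok, act, ih, and_assoc]

/-- The subset `ψ_W(x) ⊆ ∏_a C(X_a)`: the boundaries of the labels split along the decomposition
and the restrictions to shared pieces of boundary agree. This is required of `x` and of every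
permissible decomposition obtained from `x` by gluing balls, with labels composed accordingly, so
that the composition maps are defined on `ψ_W(x)` and make `ψ_W` a functor. -/
def Compat {W : Type u} [TopologicalSpace W] {l : List (Ball.{u} k)} (f : Total l → W)
    (c : Lbl S.toLabels l) : Prop :=
  Assembles k W (Total l) f ∧
  ∀ (l' : List (Ball.{u} k)) (t : Chain l l') (f' : Total l' → W), f = f' ∘ t.map →
    Assembles k W (Total l') f' → S.ok t c ∧ S.Match f' (S.act t c)

lemma Compat.act {W : Type u} [TopologicalSpace W] {l l' : List (Ball.{u} k)} {f : Total l → W}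
    {c : Lbl S.toLabels l} (h : S.Compat f c) (t : Chain l l') (f' : Total l' → W)
    (hf : f = f' ∘ t.map) (hf' : Assembles k W (Total l') f') : S.Compat f' (S.act t c) := by
  refine ⟨hf', fun l'' t' f'' e hf'' => ?_⟩
  have := h.2 l'' (t.append t') f'' (by rw [Chain.map_append, hf, e]; rfl) hf''
  rw [ok_append, act_append] at this
  exact ⟨this.1.2, this.2⟩

/-- The extension of the label functor to a `k`-manifold `W`: the colimit of `ψ_W` along the poset
of permissible decompositions of `W`. -/
def Ext (W : Type u) [TopologicalSpace W] : Type (max (u + 1) w') :=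
  Quot (fun L L' : {L : LDec S.toLabels W // S.Compat L.map L.lab} =>
    ∃ t : Chain L.1.shape L'.1.shape, L.1.map = L'.1.map ∘ t.map ∧ L'.1.lab = S.act t L.1.lab)

def Ext.mk {W : Type u} [TopologicalSpace W] (L : LDec S.toLabels W)
    (h : S.Compat L.map L.lab) : S.Ext W := Quot.mk _ ⟨L, h⟩

end System

/-! ### Invariance under homeomorphisms -/

lemma mem_bdry_iff (k : ℕ) {M M' : Type u} [TopologicalSpace M] [TopologicalSpace M']
    (e : M ≃ₜ M') (x : M) : x ∈ bdry k M ↔ e x ∈ bdry k M' := by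
  simp only [bdry, Set.mem_ofPred_eq, not_iff_not]
  constructor
  · rintro ⟨φ, hφ⟩
    exact ⟨e.symm.toOpenPartialHomeomorph.trans φ, by simpa using hφ⟩
  · rintro ⟨φ, hφ⟩
    exact ⟨e.toOpenPartialHomeomorph.trans φ, by simpa using hφ⟩

/-- The restriction of a homeomorphism to the boundaries. -/
def bdryHomeo (k : ℕ) {M M' : Type u} [TopologicalSpace M] [TopologicalSpace M'] (e : M ≃ₜ M') :
    bdry k M ≃ₜ bdry k M' := e.subtype (fun x => mem_bdry_iff k e x)

lemma Assembles.post {k : ℕ} {W W' : Type u} [TopologicalSpace W] [TopologicalSpace W']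
    {M : TopCat.{u}} {f : M → W} (h : Assembles k W M f) (g : W ≃ₜ W') :
    Assembles k W' M (g ∘ f) := by
  induction h with
  | homeo e => exact Assembles.homeo (e.trans g)
  | glue G s ih => exact Assembles.glue G ih

lemma piecesAux_push {k : ℕ} {F : Labels.{u, w} k} {M M' : Type u} (g : M → M')
    (l : List (Ball.{u} k)) (f : Total l → M) (c : Lbl F l) :
    piecesAux l (g ∘ f) c = (piecesAux l f c).map (Piece.push g) := by
  induction l with
  | nil => rfl
  | cons X l ih => exact congrArg₂ List.cons rfl (ih (f ∘ Sum.inr) c.2)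

lemma LDec.pieces_push {k : ℕ} {F : Labels.{u, w} k} {M M' : Type u} (g : M → M')
    (L : LDec F M) : (L.push g).pieces = L.pieces.map (Piece.push g) :=
  piecesAux_push g _ _ _

namespace System

variable {k : ℕ} {A : Labels.{u, w} (k - 1)} (S : System.{u, w, w'} k A)

lemma BdPieces.post {W W' : Type u} (g : W → W') (l : List (Ball.{u} k)) (f : Total l → W)
    (c : Lbl S.toLabels l) (ps : List (Piece A W)) (h : S.BdPieces l f c ps) :
    S.BdPieces l (g ∘ f) c (ps.map (Piece.push g)) := by
  induction l generalizing ps with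
  | nil => cases h; rfl
  | cons X l ih =>
    obtain ⟨L, ps', hL, hps', rfl⟩ := h
    refine ⟨L, ps'.map (Piece.push g), hL, ih (f ∘ Sum.inr) c.2 ps' hps', ?_⟩
    rw [List.map_append, ← LDec.pieces_push]
    rfl

lemma Match.post {W W' : Type u} [TopologicalSpace W] [TopologicalSpace W'] (g : W ≃ₜ W')
    {l : List (Ball.{u} k)} {f : Total l → W} {c : Lbl S.toLabels l} (h : S.Match f c) :
    S.Match (g ∘ f) c := by
  obtain ⟨L, hL, ps, P, P', h₁, h₂, h₃⟩ := h
  refine ⟨L.push (bdryHomeo k g), hL.post _, ps.map (Piece.push g), P.map (Piece.push g),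
    P'.map (Piece.push g), BdPieces.post S g l f c ps h₁, ?_, ?_⟩
  · rw [List.forall₂_map_left_iff, List.forall₂_map_right_iff]
    refine h₂.imp ?_
    rintro p q ⟨e, he, he'⟩
    exact ⟨e, by simp only [Piece.push, he]; rfl, he'⟩
  · have := h₃.map (Piece.push g)
    rw [List.map_append, List.map_append, ← LDec.pieces_push] at this
    exact this

lemma Compat.post {W W' : Type u} [TopologicalSpace W] [TopologicalSpace W'] (g : W ≃ₜ W')
    {l : List (Ball.{u} k)} {f : Total l → W} {c : Lbl S.toLabels l} (h : S.Compat f c) :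
    S.Compat (g ∘ f) c := by
  refine ⟨h.1.post g, fun l' t f' e hf' => ?_⟩
  obtain ⟨h₁, h₂⟩ := h.2 l' t (g.symm ∘ f')
    (by rw [Function.comp_assoc, ← e]; ext x; simp) (hf'.post g.symm)
  refine ⟨h₁, ?_⟩
  have := Match.post S g h₂
  rwa [show g ∘ (g.symm ∘ f') = f' by ext x; simp] at this

/-- The action of a homeomorphism on the extension of the label functor to manifolds. -/
def Ext.map {W W' : Type u} [TopologicalSpace W] [TopologicalSpace W'] (g : W ≃ₜ W') :
    S.Ext W → S.Ext W' :=
  Quot.map (fun L => ⟨L.1.push g, Compat.post S g L.2⟩) (by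
    rintro L L' ⟨t, h₁, h₂⟩
    exact ⟨t, by simp only [LDec.push, h₁]; rfl, h₂⟩)

end System

/-! ### Laws of composition -/

namespace System

variable {k : ℕ} {A : Labels.{u, w} (k - 1)} (S : System.{u, w, w'} k A)

/-- Composition is natural with respect to homeomorphisms. -/
def GlNatural : Prop :=
  ∀ {B₁ B₂ B B₁' B₂' B' : Ball.{u} k} (G : BallGluing k B₁ B₂ B) (G' : BallGluing k B₁' B₂' B')
    (e₁ : B₁ ≃ₜ B₁') (e₂ : B₂ ≃ₜ B₂') (e : B ≃ₜ B') (c₁ : S.obj B₁) (c₂ : S.obj B₂),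
    G'.map ∘ Sum.map e₁ e₂ = e ∘ G.map → S.Composable G c₁ c₂ →
    S.gl G' (S.map e₁ c₁) (S.map e₂ c₂) = S.map e (S.gl G c₁ c₂)

/-- Composition is compatible with restriction to the intersections of `∂B` with `∂B₁`, `∂B₂`: the
boundary value of a composite consists of the parts of the boundary values which have not been
glued. The boundary value is a class of labelled decompositions satisfying `low`. -/
def GlBoundary (low : ∀ B : Ball.{u} k, LDec A (bdry k B) → Prop) : Prop :=
  ∀ {B₁ B₂ B : Ball.{u} k} (G : BallGluing k B₁ B₂ B) (c₁ : S.obj B₁) (c₂ : S.obj B₂)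
    (L : LDec A (bdry k B)), S.MatchBd (pairMap G) (S.pairLbl c₁ c₂) L → low B L →
    S.bd B (S.gl G c₁ c₂) L

/-- Strict associativity: any two sequences of gluings which assemble the same balls from the
same smaller balls have the same composite. -/
def GlAssoc : Prop :=
  ∀ (W : Type u) [TopologicalSpace W] (l l' : List (Ball.{u} k)) (f : Total l → W)
    (f' : Total l' → W) (t t' : Chain l l') (c : Lbl S.toLabels l), S.Compat f c →
    Assembles k W (Total l') f' → f = f' ∘ t.map → f = f' ∘ t'.map → S.act t c = S.act t' c

end System

/-- The morphisms of an `n`-category in dimensions `k < n` (the values for `k ≥ n` carry no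
conditions and are not used), with their boundary values and compositions. -/
structure LowerData where
  mor : ∀ k : ℕ, Labels.{u, w} k
  bd : ∀ (k : ℕ) (X : Ball.{u} k), (mor k).obj X → LDec (mor (k - 1)) (bdry k X) → Prop
  gl : ∀ (k : ℕ) {B₁ B₂ B : Ball.{u} k}, BallGluing k B₁ B₂ B →
    (mor k).obj B₁ → (mor k).obj B₂ → (mor k).obj B

def LowerData.sys (D : LowerData.{u, w}) (k : ℕ) : System.{u, w, w} k (D.mor (k - 1)) where
  toLabels := D.mor k
  bd := D.bd k
  gl := D.gl k

/-- `L` represents an element of the extension of the `(k-1)`-morphisms to `∂X`. -/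
def LowerData.BdCompat (D : LowerData.{u, w}) (k : ℕ) (X : Ball.{u} k)
    (L : LDec (D.mor (k - 1)) (bdry k X)) : Prop :=
  (D.sys (k - 1)).Compat L.map L.lab

/-- The laws for the morphisms in dimensions `k < n`. -/
structure LowerCategory (n : ℕ) extends LowerData.{u, w} where
  /-- The labelled decompositions representing the boundary value of a `k`-morphism form exactly
  one element of the extension of the `(k-1)`-morphisms to the `(k-1)`-sphere `∂X`. -/
  bd_class : ∀ k < n, ∀ (X : Ball.{u} k) (c : (mor k).obj X),
    ∃ b : (toLowerData.sys (k - 1)).Ext (bdry k X), ∀ L, bd k X c L ↔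
      ∃ h : toLowerData.BdCompat k X L, System.Ext.mk (toLowerData.sys (k - 1)) L h = b
  bd_natural : ∀ k < n, ∀ {X X' : Ball.{u} k} (e : X ≃ₜ X') (c : (mor k).obj X) (L),
    bd k X c L → bd k X' ((mor k).map e c) (L.push (bdryHomeo k e))
  gl_natural : ∀ k < n, (toLowerData.sys k).GlNatural
  gl_boundary : ∀ k < n, (toLowerData.sys k).GlBoundary (toLowerData.BdCompat k)
  gl_injective : ∀ k < n, ∀ {B₁ B₂ B : Ball.{u} k} (G : BallGluing k B₁ B₂ B)
    (c₁ c₁' : (mor k).obj B₁) (c₂ c₂' : (mor k).obj B₂),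
    (toLowerData.sys k).Composable G c₁ c₂ → (toLowerData.sys k).Composable G c₁' c₂' →
    gl k G c₁ c₂ = gl k G c₁' c₂' → c₁ = c₁' ∧ c₂ = c₂'
  gl_assoc : ∀ k < n, (toLowerData.sys k).GlAssoc

/-- The set of boundary values of `n`-morphisms on the `n`-ball `X`: the extension of the
`(n-1)`-morphisms to `∂X` (for `n = 0` this is a point, as `∂X` is empty). -/
def LowerData.BVal (D : LowerData.{u, w}) (n : ℕ) (X : Ball.{u} n) : Type (max (u + 1) w) :=
  (D.sys (n - 1)).Ext (bdry n X)

def LowerData.bvalLabels (D : LowerData.{u, w}) (n : ℕ) : Labels.{u, max (u + 1) w} n where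
  obj := D.BVal n
  map e := System.Ext.map _ (bdryHomeo n e)
  map_refl X c := by
    induction c using Quot.ind
    rfl
  map_trans e e' c := by
    induction c using Quot.ind
    rfl

/-- The system of boundary values in dimension `n`, with a given composition of boundary values. -/
def LowerData.topSys (D : LowerData.{u, w}) (n : ℕ)
    (bgl : ∀ {B₁ B₂ B : Ball.{u} n}, BallGluing n B₁ B₂ B →
      D.BVal n B₁ → D.BVal n B₂ → D.BVal n B) :
    System.{u, w, max (u + 1) w} n (D.mor (n - 1)) where
  toLabels := D.bvalLabels n
  bd X b L := ∃ h : D.BdCompat n X L, System.Ext.mk (D.sys (n - 1)) L h = b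
  gl := bgl

/-! ### Enrichment in chain complexes -/

/-- Chain complexes of `R`-modules. -/
abbrev Ch (R : Type v) [CommRing R] := ChainComplex (ModuleCat.{v} R) ℕ

/-- The Koszul signs `(-1)^(pq)`. -/
instance : TotalComplexShapeSymmetry (ComplexShape.down ℕ) (ComplexShape.down ℕ)
    (ComplexShape.down ℕ) where
  symm p q := add_comm q p
  σ p q := (-1) ^ (p * q)
  σ_ε₁ := by
    rintro _ p rfl q
    change (-1 : ℤˣ) ^ ((p + 1) * q) * 1 = (-1 : ℤˣ) ^ q * (-1) ^ (p * q)
    rw [add_mul, one_mul, pow_add, mul_one, mul_comm]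
  σ_ε₂ := by
    rintro p _ q rfl
    change (-1 : ℤˣ) ^ (p * (q + 1)) * (-1 : ℤˣ) ^ p = 1 * (-1 : ℤˣ) ^ (p * q)
    rw [mul_add, mul_one, pow_add, mul_assoc, Int.units_mul_self, mul_one, one_mul]

section Tensor

variable {R : Type v} [CommRing R]

def swapBicomplex (K L : Ch R) :
    (((curriedTensor (ModuleCat.{v} R)).mapBifunctorHomologicalComplex _ _).obj K).obj L ⟶
    (((curriedTensor (ModuleCat.{v} R)).flip.mapBifunctorHomologicalComplex _ _).obj K).obj L :=
  HomologicalComplex₂.homMk (fun i => (β_ (K.X i.1) (L.X i.2)).hom)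
    (by intros; exact (BraidedCategory.braiding_naturality_left (C := ModuleCat.{v} R) _ _).symm)
    (by intros; exact (BraidedCategory.braiding_naturality_right (C := ModuleCat.{v} R) _ _).symm)

/-- The exchange `K ⊗ L ⟶ L ⊗ K`, `a ⊗ b ↦ (-1)^(deg a * deg b) b ⊗ a`, of chain complexes. -/
def koszulSwap (K L : Ch R) : K ⊗ L ⟶ L ⊗ K :=
  HomologicalComplex₂.total.map (swapBicomplex K L) (ComplexShape.down ℕ) ≫
    (HomologicalComplex.mapBifunctorFlipIso L K (curriedTensor (ModuleCat.{v} R))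
      (ComplexShape.down ℕ)).hom

end Tensor

/-- The data of a disk-like `n`-category enriched in chain complexes of `R`-modules, as far as the
blob complex depends on it: morphisms, boundaries and gluing. For an `n`-ball `X` and a boundary
value `b`, `hom X b` is the complex of `n`-morphisms `C(X; b)`; an enrichment in `R`-modules is the
case of complexes concentrated in degree `0`. The values of `bgl` and `hgl` matter only on
composable pairs. -/
structure PreNCategoryData (n : ℕ) (R : Type v) [CommRing R] extends LowerCategory.{u, w} n where
  bgl : ∀ {B₁ B₂ B : Ball.{u} n}, BallGluing n B₁ B₂ B →
    toLowerData.BVal n B₁ → toLowerData.BVal n B₂ → toLowerData.BVal n B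
  hom : ∀ X : Ball.{u} n, toLowerData.BVal n X → Ch R
  hmap : ∀ {X X' : Ball.{u} n} (e : X ≃ₜ X') (b : toLowerData.BVal n X),
    hom X b ⟶ hom X' ((toLowerData.bvalLabels n).map e b)
  hgl : ∀ {B₁ B₂ B : Ball.{u} n} (G : BallGluing n B₁ B₂ B) (b₁ : toLowerData.BVal n B₁)
    (b₂ : toLowerData.BVal n B₂), hom B₁ b₁ ⊗ hom B₂ b₂ ⟶ hom B (bgl G b₁ b₂)

namespace PreNCategoryData

variable {n : ℕ} {R : Type v} [CommRing R] (C : PreNCategoryData.{u, w} n R)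

def sys : System.{u, w, max (u + 1) w} n (C.mor (n - 1)) := C.toLowerData.topSys n C.bgl

/-- The tensor product `⨂_a C(X_a; b_a)`. -/
def tensor : (l : List (Ball.{u} n)) → Lbl C.sys.toLabels l → Ch R
  | [], _ => 𝟙_ (Ch R)
  | X :: l, b => C.hom X b.1 ⊗ tensor l b.2

/-- The action of a step on `n`-morphisms with boundary values `b`. -/
def stepMap : {l l' : List (Ball.{u} n)} → (s : Step l l') → (b : Lbl C.sys.toLabels l) →
    (C.tensor l b ⟶ C.tensor l' (C.sys.stepAct s b))
  | _, _, .homeo e l, b => C.hmap e b.1 ▷ C.tensor l b.2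
  | _, _, .swap X X' l, b =>
      (α_ (C.hom X b.1) (C.hom X' b.2.1) (C.tensor l b.2.2)).inv ≫
        koszulSwap (C.hom X b.1) (C.hom X' b.2.1) ▷ C.tensor l b.2.2 ≫
        (α_ (C.hom X' b.2.1) (C.hom X b.1) (C.tensor l b.2.2)).hom
  | _, _, .glue (B₁ := B₁) (B₂ := B₂) G l, b =>
      (α_ (C.hom B₁ b.1) (C.hom B₂ b.2.1) (C.tensor l b.2.2)).inv ≫
        C.hgl G b.1 b.2.1 ▷ C.tensor l b.2.2
  | _, _, .cons X s, b => C.hom X b.1 ◁ stepMap s b.2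

/-- The composition of `n`-morphisms along a sequence of gluings. -/
def chainMap : {l l' : List (Ball.{u} n)} → (t : Chain l l') → (b : Lbl C.sys.toLabels l) →
    (C.tensor l b ⟶ C.tensor l' (C.sys.act t b))
  | _, _, .nil l, b => 𝟙 (C.tensor l b)
  | _, _, .cons s t, b => C.stepMap s b ≫ chainMap t (C.sys.stepAct s b)

/-- The composition along a chain, together with the boundary values of the composites. -/
def chainMap' {l l' : List (Ball.{u} n)} (t : Chain l l') (b : Lbl C.sys.toLabels l) :
    Σ b' : Lbl C.sys.toLabels l', (C.tensor l b ⟶ C.tensor l' b') :=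
  ⟨C.sys.act t b, C.chainMap t b⟩

lemma chainMap'_append {l l' l'' : List (Ball.{u} n)} (t : Chain l l') (t' : Chain l' l'')
    (b : Lbl C.sys.toLabels l) : C.chainMap' (t.append t') b =
      ⟨(C.chainMap' t' (C.chainMap' t b).1).1,
        (C.chainMap' t b).2 ≫ (C.chainMap' t' (C.chainMap' t b).1).2⟩ := by
  induction t with
  | nil => exact congrArg (Sigma.mk _) (Category.id_comp _).symm
  | cons s t ih =>
    have := ih t' (C.sys.stepAct s b)
    refine (congrArg (fun p : (Σ b' : Lbl C.sys.toLabels l'', (C.tensor _ _ ⟶ C.tensor l'' b')) =>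
      (⟨p.1, C.stepMap s b ≫ p.2⟩ : Σ b' : Lbl C.sys.toLabels l'',
        (C.tensor _ b ⟶ C.tensor l'' b'))) this).trans ?_
    exact congrArg (Sigma.mk _) (Category.assoc _ _ _).symm

end PreNCategoryData

/-- A disk-like `n`-category without its product morphisms: morphisms, boundaries, gluing and strict
associativity. Every ordinary and every `A_∞` `n`-category (enriched in `R`-modules or in chain
complexes) has an underlying `PreNCategory`; product morphisms, isotopy invariance and the action of
families of homeomorphisms are further data and conditions, which do not enter the construction of
the blob complex and are not assumed. -/
structure PreNCategory (n : ℕ) (R : Type v) [CommRing R] extends PreNCategoryData.{u, w} n R where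
  bgl_natural : toPreNCategoryData.sys.GlNatural
  bgl_boundary : toPreNCategoryData.sys.GlBoundary (toLowerData.BdCompat n)
  hmap_refl : ∀ (X : Ball.{u} n) (b : toLowerData.BVal n X),
    (⟨_, hmap (Homeomorph.refl X) b⟩ : Σ b', (hom X b ⟶ hom X b')) = ⟨b, 𝟙 _⟩
  hmap_trans : ∀ {X X' X'' : Ball.{u} n} (e : X ≃ₜ X') (e' : X' ≃ₜ X'')
    (b : toLowerData.BVal n X),
    (⟨_, hmap (e.trans e') b⟩ : Σ b', (hom X b ⟶ hom X'' b')) = ⟨_, hmap e b ≫ hmap e' _⟩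
  hgl_natural : ∀ {B₁ B₂ B B₁' B₂' B' : Ball.{u} n} (G : BallGluing n B₁ B₂ B)
    (G' : BallGluing n B₁' B₂' B') (e₁ : B₁ ≃ₜ B₁') (e₂ : B₂ ≃ₜ B₂') (e : B ≃ₜ B')
    (b₁ : toLowerData.BVal n B₁) (b₂ : toLowerData.BVal n B₂),
    G'.map ∘ Sum.map e₁ e₂ = e ∘ G.map → toPreNCategoryData.sys.Composable G b₁ b₂ →
    (⟨_, (hmap e₁ b₁ ⊗ₘ hmap e₂ b₂) ≫ hgl G' _ _⟩ : Σ b', (hom B₁ b₁ ⊗ hom B₂ b₂ ⟶ hom B' b')) =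
      ⟨_, hgl G b₁ b₂ ≫ hmap e _⟩
  hgl_assoc : ∀ (W : Type u) [TopologicalSpace W] (l l' : List (Ball.{u} n)) (f : Total l → W)
    (f' : Total l' → W) (t t' : Chain l l') (b : Lbl toPreNCategoryData.sys.toLabels l),
    toPreNCategoryData.sys.Compat f b → Assembles n W (Total l') f' →
    f = f' ∘ t.map → f = f' ∘ t'.map →
    toPreNCategoryData.chainMap' t b = toPreNCategoryData.chainMap' t' b

/-! ### The blob complex -/

/-- Chain complexes of `R`-modules in a universe with direct sums over all decompositions. -/
abbrev BigCh (R : Type v) [CommRing R] := ChainComplex (ModuleCat.{max v (u + 1) w} R) ℕ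

/-- The simplices `x₀ ≤ ⋯ ≤ x_m` of a preordered set. -/
abbrev Simplex (P : Type w) [Preorder P] (m : ℕ) := Fin (m + 1) →o P

section Srep

variable {P : Type w} [Preorder P] {𝒜 : Type u} [Category.{v} 𝒜] [HasCoproducts.{w} 𝒜] (F : P ⥤ 𝒜)

/-- The direct sum of `F(x₀)` over the simplices `x₀ ≤ ⋯ ≤ x_m`. -/
def srepObj (m : ℕ) : 𝒜 := ∐ fun s : Simplex P m => F.obj (s 0)

/-- The inclusion of the summand with index `s`. -/
def srepι {m : ℕ} (s : Simplex P m) : F.obj (s 0) ⟶ srepObj F m :=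
  Sigma.ι (fun s : Simplex P m => F.obj (s 0)) s

def srepDesc {m : ℕ} {Z : 𝒜} (φ : ∀ s : Simplex P m, F.obj (s 0) ⟶ Z) : srepObj F m ⟶ Z :=
  Sigma.desc φ

@[simp]
lemma srepι_desc {m : ℕ} {Z : 𝒜} (φ : ∀ s : Simplex P m, F.obj (s 0) ⟶ Z) (s : Simplex P m) :
    srepι F s ≫ srepDesc F φ = φ s := Sigma.ι_desc _ _

lemma srep_hom_ext {m : ℕ} {Z : 𝒜} {f g : srepObj F m ⟶ Z}
    (h : ∀ s, srepι F s ≫ f = srepι F s ≫ g) : f = g := Sigma.hom_ext _ _ h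

/-- The simplicial replacement of a functor on a preordered set. -/
def srep : SimplicialObject 𝒜 where
  obj Δ := srepObj F Δ.unop.len
  map {Δ Δ'} σ := srepDesc F fun s =>
    F.map (homOfLE (show s 0 ≤ (s.comp σ.unop.toOrderHom) 0 from s.monotone (Fin.zero_le _))) ≫
      srepι F (s.comp σ.unop.toOrderHom)
  map_id Δ := by
    refine srep_hom_ext F fun s => ?_
    rw [srepι_desc, Category.comp_id]
    change F.map (𝟙 _) ≫ srepι F s = _
    rw [F.map_id, Category.id_comp]
  map_comp {Δ Δ' Δ''} σ τ := by
    refine srep_hom_ext F fun s => ?_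
    rw [srepι_desc, ← Category.assoc, srepι_desc]
    refine Eq.trans ?_ (Category.assoc (F.map _) (srepι F _) (srepDesc F _)).symm
    rw [srepι_desc]
    refine Eq.trans ?_ (Category.assoc (F.map _) (F.map _) (srepι F _))
    rw [← F.map_comp]
    rfl

end Srep

namespace PreNCategory

variable {n : ℕ} {R : Type v} [CommRing R] (C : PreNCategory.{u, w} n R)

section

variable (W : Type u) [TopologicalSpace W]

/-- Boundary labels on a decomposition for which all restrictions to shared boundaries agree. -/
abbrev Bdl {W : Type u} [TopologicalSpace W] (x : Decomp.{u} n W) :=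
  {b : Lbl C.sys.toLabels x.shape // C.sys.Compat x.map b}

/-- The tensor product `⨂_a C(X_a; b_a)`, in a larger universe. -/
def term {W : Type u} [TopologicalSpace W] (x : Decomp.{u} n W) (b : C.Bdl x) :
    BigCh.{u, w, v} R :=
  ((ModuleCat.uliftFunctor.{max (u + 1) w, v} R).mapHomologicalComplex _).obj
    (C.tensor x.shape b.1)

/-- `ψ_W(x)`: the direct sum of `⨂_a C(X_a; b_a)` over all compatible boundary labels `b`. -/
def ψObj (x : Decomp.{u} n W) : BigCh.{u, w, v} R := ∐ fun b : C.Bdl x => C.term x b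

variable {W}

/-- The inclusion of the summand with boundary labels `b`. -/
def ψι {x : Decomp.{u} n W} (b : C.Bdl x) : C.term x b ⟶ C.ψObj W x :=
  Sigma.ι (fun b : C.Bdl x => C.term x b) b

def ψDesc {x : Decomp.{u} n W} {Z : BigCh.{u, w, v} R} (φ : ∀ b : C.Bdl x, C.term x b ⟶ Z) :
    C.ψObj W x ⟶ Z := Sigma.desc φ

@[simp]
lemma ψι_desc {x : Decomp.{u} n W} {Z : BigCh.{u, w, v} R} (φ : ∀ b : C.Bdl x, C.term x b ⟶ Z)
    (b : C.Bdl x) : C.ψι b ≫ C.ψDesc φ = φ b := Sigma.ι_desc _ _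

lemma ψ_hom_ext {x : Decomp.{u} n W} {Z : BigCh.{u, w, v} R} {f g : C.ψObj W x ⟶ Z}
    (h : ∀ b, C.ψι b ≫ f = C.ψι b ≫ g) : f = g := Sigma.hom_ext _ _ h

/-- The map to `ψ_W(y)` given by a morphism `⨂_a C(X_a; b_a) ⟶ ⨂_a C(Y_a; b'_a)`. -/
def ψIncl {x y : Decomp.{u} n W} (b : C.Bdl x)
    (p : Σ b' : Lbl C.sys.toLabels y.shape, (C.tensor x.shape b.1 ⟶ C.tensor y.shape b'))
    (h : C.sys.Compat y.map p.1) : C.term x b ⟶ C.ψObj W y :=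
  ((ModuleCat.uliftFunctor.{max (u + 1) w, v} R).mapHomologicalComplex _).map p.2 ≫
    C.ψι (x := y) ⟨p.1, h⟩

lemma chain_compat {x y : Decomp.{u} n W} (h : x ≤ y) (b : C.Bdl x) :
    C.sys.Compat y.map (C.chainMap' h.choose b.1).1 :=
  b.2.act _ h.choose y.map h.choose_spec y.permissible

lemma ψIncl_congr {x y : Decomp.{u} n W} (b : C.Bdl x)
    {p q : Σ b' : Lbl C.sys.toLabels y.shape, (C.tensor x.shape b.1 ⟶ C.tensor y.shape b')}
    (e : p = q) (hp : C.sys.Compat y.map p.1) (hq : C.sys.Compat y.map q.1) :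
    C.ψIncl b p hp = C.ψIncl b q hq := by
  subst e
  rfl

variable (W)

/-- The functor `ψ_W`, given on morphisms by the composition maps of `C`. -/
def ψ : Decomp.{u} n W ⥤ BigCh.{u, w, v} R where
  obj x := C.ψObj W x
  map {_ _} h := C.ψDesc fun b =>
    C.ψIncl b (C.chainMap' h.le.choose b.1) (C.chain_compat h.le b)
  map_id x := by
    refine C.ψ_hom_ext fun b => ?_
    rw [ψι_desc, Category.comp_id]
    have e := C.hgl_assoc W x.shape x.shape x.map x.map (le_refl x).choose (.nil _) b.1 b.2
      x.permissible (le_refl x).choose_spec rfl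
    refine (C.ψIncl_congr b e _ b.2).trans ?_
    exact (congrArg (· ≫ _) (CategoryTheory.Functor.map_id _ _)).trans (Category.id_comp _)
  map_comp {x y z} f g := by
    refine C.ψ_hom_ext fun b => ?_
    rw [ψι_desc, ← Category.assoc, ψι_desc]
    have e := C.hgl_assoc W x.shape z.shape x.map z.map (f ≫ g).le.choose
      (f.le.choose.append g.le.choose) b.1 b.2 z.permissible (f ≫ g).le.choose_spec
      (by rw [Chain.map_append, ← Function.comp_assoc, ← g.le.choose_spec]
          exact f.le.choose_spec)
    rw [C.chainMap'_append] at e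
    refine (C.ψIncl_congr b e _
      (C.chain_compat g.le ⟨_, C.chain_compat f.le b⟩)).trans ?_
    rw [ψIncl, ψIncl]
    refine Eq.trans ?_ (Category.assoc _ (C.ψι _) (C.ψDesc _)).symm
    rw [ψι_desc, ψIncl]
    exact (congrArg (· ≫ _) (CategoryTheory.Functor.map_comp _ _ _)).trans (Category.assoc _ _ _)

/-- The blob complex `B_*(W; C)`: the homotopy colimit of `ψ_W`, realized by simplices. Its
differential on `(x̄, a)` is `(x̄, ∂a) + (-1)^(deg a) ∑ᵢ (-1)^i dᵢ(x̄, a)`. -/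
def blob : BigCh.{u, w, v} R :=
  HomologicalComplex₂.total
    (HomologicalComplex₂.flip
      ((AlgebraicTopology.alternatingFaceMapComplex (BigCh.{u, w, v} R)).obj (srep (C.ψ W))))
    (ComplexShape.down ℕ)

variable {W}

/-- The inclusion of the summand `(⨂_a C(X_a; b_a))_q`, where `x₀ = {X_a}`, indexed by the simplex
`x̄ = (x₀ ≤ ⋯ ≤ x_m)` and the boundary labels `b` into the blob complex. -/
def gen {m : ℕ} (s : Simplex (Decomp.{u} n W) m) (b : C.Bdl (s 0)) (q : ℕ) :
    (C.term (s 0) b).X q ⟶ (C.blob W).X (q + m) :=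
  (C.ψι b ≫ srepι (C.ψ W) s).f q ≫
    HomologicalComplex₂.ιTotal (HomologicalComplex₂.flip
      ((AlgebraicTopology.alternatingFaceMapComplex (BigCh.{u, w, v} R)).obj (srep (C.ψ W))))
      (ComplexShape.down ℕ) q m (q + m) rfl

end

end PreNCategory

/-! ### The category of manifolds and homeomorphisms -/

/-- A homeomorphism `f : W ≃ₜ W'` carries a decomposition `⊔ X_a → W` to the decomposition
`⊔ X_a → W → W'`. -/
def Decomp.push {n : ℕ} {W W' : Type u} [TopologicalSpace W] [TopologicalSpace W'] (f : W ≃ₜ W') :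
    Decomp.{u} n W →o Decomp.{u} n W' where
  toFun x := ⟨x.shape, f ∘ x.map, x.permissible.post f⟩
  monotone' x y := by
    rintro ⟨t, ht⟩
    exact ⟨t, by simp only [ht]; rfl⟩

/-- The same boundary labels, on the image of a decomposition under a homeomorphism. -/
def PreNCategory.Bdl.push {n : ℕ} {R : Type v} [CommRing R] {C : PreNCategory.{u, w} n R}
    {W W' : Type u} [TopologicalSpace W] [TopologicalSpace W'] (f : W ≃ₜ W')
    {x : Decomp.{u} n W} (b : C.Bdl x) : C.Bdl (Decomp.push f x) :=
  ⟨b.1, b.2.post _ f⟩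

/-- An `n`-manifold, possibly with boundary. -/
structure Mfd (n : ℕ) where
  carrier : TopCat.{u}
  isMfd : IsMfd n carrier

instance (n : ℕ) : CoeSort (Mfd.{u} n) (Type u) := ⟨fun W => W.carrier⟩

/-- The category of `n`-manifolds and homeomorphisms. -/
instance (n : ℕ) : Category (Mfd.{u} n) where
  Hom W W' := W ≃ₜ W'
  id W := Homeomorph.refl W
  comp f g := f.trans g

end Blob

/-! The blob complex sees `W` only through the preordered set of decompositions `Decomp n W` and the
functor `ψ W` on it. A homeomorphism `f : W ≃ₜ W'` changes neither the balls of a decomposition nor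
their labels, only the map to the manifold. Hence `Decomp.push f` is monotone (the same chain of
gluings witnesses `f ∘ x ≤ f ∘ y`), compatibility of labels is preserved by `Compat.post`, and the
summands `term x b` and `term (f ∘ x) (b.push f)` are literally the same complex. The map `ψ W x ⟶ ψ
W' (f ∘ x)` is the identity on each summand. In particular, `f` itself never acts on the morphisms
of `C`.

The one point that needs an axiom of `C` is naturality in `x` (`ψPush_naturality`). The composition
map for `x ≤ y` is defined by a chosen chain of gluings, and the chain chosen for `f ∘ x ≤ f ∘ y`
may be another one. Strict associativity `hgl_assoc` says that the two have the same composite.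

The rest is formal: a monotone map with a natural transformation over it induces a map of simplicial
replacements (`srepMap`), strictly compatible with identities and composition, and the alternating
face map complex, the flip and the total complex are functors. Invertibility follows from
functoriality applied to `f` and `f.symm`. -/

namespace Blob

/-! ### Functoriality of the simplicial replacement in the indexing order and the functor. -/

section Srep

variable {P Q T : Type w} [Preorder P] [Preorder Q] [Preorder T] {𝒜 : Type u} [Category.{v} 𝒜]
  [HasCoproducts.{w} 𝒜] (F : P ⥤ 𝒜) (G : Q ⥤ 𝒜) (H : T ⥤ 𝒜)

/-- The map of simplicial replacements induced by a monotone map `φ` and a natural transformation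
`F ⟶ G ∘ φ`. -/
def srepMap (φ : P →o Q) (α : ∀ x, F.obj x ⟶ G.obj (φ x))
    (hα : ∀ (x y : P) (h : x ≤ y),
      F.map (homOfLE h) ≫ α y = α x ≫ G.map (homOfLE (φ.monotone h))) :
    srep F ⟶ srep G where
  app Δ := srepDesc F fun s => α (s 0) ≫ srepι G (φ.comp s)
  naturality Δ Δ' σ := by
    refine srep_hom_ext F fun s => ?_
    -- A simplicial operator may move the initial vertex (as the face `d₀` does), and the
    -- coefficient is then carried along this inequality. Naturality `hα` is needed for exactly this
    -- arrow.
    have h : s 0 ≤ (s.comp σ.unop.toOrderHom) 0 := s.monotone (Fin.zero_le _)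
    have h₁ : srepι F s ≫ (srep F).map σ =
        F.map (homOfLE h) ≫ srepι F (s.comp σ.unop.toOrderHom) := srepι_desc F _ s
    have h₂ : srepι G (φ.comp s) ≫ (srep G).map σ =
        G.map (homOfLE (φ.monotone h)) ≫ srepι G (φ.comp (s.comp σ.unop.toOrderHom)) :=
      srepι_desc G _ (φ.comp s)
    refine (Category.assoc _ _ _).symm.trans ((congrArg (· ≫ _) h₁).trans ?_)
    refine (Category.assoc _ _ _).trans ((congrArg (_ ≫ ·) (srepι_desc F _ _)).trans ?_)
    refine (Category.assoc _ _ _).symm.trans ((congrArg (· ≫ _) (hα _ _ h)).trans ?_)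
    refine (Category.assoc _ _ _).trans ((congrArg (_ ≫ ·) h₂.symm).trans ?_)
    refine (Category.assoc _ _ _).symm.trans ((congrArg (· ≫ (srep G).map σ) (srepι_desc F
      (fun s => α (s 0) ≫ srepι G (φ.comp s)) s).symm).trans ?_)
    exact Category.assoc _ _ _

lemma srepι_srepMap (φ : P →o Q) (α : ∀ x, F.obj x ⟶ G.obj (φ x)) (hα) {m : ℕ}
    (s : Simplex P m) :
    srepι F s ≫ (srepMap F G φ α hα).app (Opposite.op (SimplexCategory.mk m)) =
      α (s 0) ≫ srepι G (φ.comp s) :=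
  srepι_desc F _ s

/-- The components `α x` are only assumed equal to identities, because in the application
`Decomp.push` of the identity is `OrderHom.id` definitionally while `ψPush` of the identity is `𝟙`
only by a proof. The free `γ` in `srepMap_eq_comp` serves the same purpose. -/
lemma srepMap_eq_id (α : ∀ x, F.obj x ⟶ F.obj x) (hα) (h : ∀ x, α x = 𝟙 (F.obj x)) :
    srepMap F F OrderHom.id α hα = 𝟙 (srep F) := by
  refine NatTrans.ext (funext fun Δ => srep_hom_ext F fun s => ?_)
  refine (srepι_desc F _ s).trans ((congrArg (· ≫ _) (h _)).trans ?_)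
  exact (Category.id_comp _).trans (Category.comp_id _).symm

lemma srepMap_eq_comp (φ : P →o Q) (φ' : Q →o T) (α : ∀ x, F.obj x ⟶ G.obj (φ x)) (hα)
    (β : ∀ x, G.obj x ⟶ H.obj (φ' x)) (hβ) {γ : ∀ x, F.obj x ⟶ H.obj (φ' (φ x))} {hγ}
    (h : ∀ x, γ x = α x ≫ β (φ x)) :
    srepMap F H (φ'.comp φ) γ hγ = srepMap F G φ α hα ≫ srepMap G H φ' β hβ := by
  refine NatTrans.ext (funext fun Δ => srep_hom_ext F fun s => ?_)
  refine (srepι_desc F _ s).trans ((congrArg (· ≫ _) (h _)).trans ?_)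
  refine (Category.assoc _ _ _).trans ?_
  refine (congrArg (α (s 0) ≫ ·) (srepι_desc G
    (fun s => β (s 0) ≫ srepι H (φ'.comp s)) (φ.comp s)).symm).trans ?_
  refine (Category.assoc _ _ _).symm.trans ((congrArg (· ≫ (srepMap G H φ' β hβ).app Δ)
    (srepι_desc F (fun s => α (s 0) ≫ srepι G (φ.comp s)) s).symm).trans ?_)
  exact Category.assoc _ _ _

end Srep

/-! ### The comparison of `ψ W` with `ψ W'` along a homeomorphism. -/

namespace PreNCategory

variable {n : ℕ} {R : Type v} [CommRing R] (C : PreNCategory.{u, w} n R)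
  {W W' W'' : Type u} [TopologicalSpace W] [TopologicalSpace W'] [TopologicalSpace W'']

/-- The inclusion of the summand of `ψ_{W'}(f ∘ x)` with the same balls and boundary labels. -/
def ψPushι (f : W ≃ₜ W') {x : Decomp.{u} n W} (b : C.Bdl x) :
    C.term x b ⟶ C.ψObj W' (Decomp.push f x) :=
  C.ψι (x := Decomp.push f x) (b.push f)

/-- A homeomorphism `f : W ≃ₜ W'` identifies `ψ_W(x)` with `ψ_{W'}(f ∘ x)`. -/
def ψPush (f : W ≃ₜ W') (x : Decomp.{u} n W) : C.ψObj W x ⟶ C.ψObj W' (Decomp.push f x) :=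
  C.ψDesc fun b => C.ψPushι f b

@[simp]
lemma ψι_ψPush (f : W ≃ₜ W') {x : Decomp.{u} n W} (b : C.Bdl x) :
    C.ψι b ≫ C.ψPush f x = C.ψPushι f b :=
  C.ψι_desc _ _

/-- On a summand both sides are composition along a chain from the balls of `x` to the balls of `y`:
on the left the chain chosen for `x ≤ y`, on the right the one chosen for `f ∘ x ≤ f ∘ y`. Strict
associativity identifies them. -/
lemma ψPush_naturality (f : W ≃ₜ W') {x y : Decomp.{u} n W} (h : x ≤ y) :
    (C.ψ W).map (homOfLE h) ≫ C.ψPush f y =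
      C.ψPush f x ≫ (C.ψ W').map (homOfLE ((Decomp.push f).monotone h)) := by
  refine C.ψ_hom_ext fun b => ?_
  have h' := (Decomp.push f).monotone h
  -- Associativity is applied over `W'`: composing the equation for `h.choose` with `f` makes it a
  -- second factorization of `f ∘ x.map` through `f ∘ y.map`.
  have e := C.hgl_assoc W' x.shape y.shape (f ∘ x.map) (f ∘ y.map) h.choose h'.choose b.1
    (b.2.post _ f) (Decomp.push f y).permissible
    (congrArg (f ∘ ·) h.choose_spec) h'.choose_spec
  have hl : C.ψι b ≫ (C.ψ W).map (homOfLE h) =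
      C.ψIncl b (C.chainMap' h.choose b.1) (C.chain_compat h b) := C.ψι_desc _ _
  have hr : C.ψPushι f b ≫ (C.ψ W').map (homOfLE h') =
      C.ψIncl (b.push f) (C.chainMap' h'.choose b.1) (C.chain_compat h' (b.push f)) :=
    C.ψι_desc _ _
  have hc : C.ψIncl b (C.chainMap' h.choose b.1) (C.chain_compat h b) ≫ C.ψPush f y =
      C.ψIncl (y := Decomp.push f y) (b.push f) (C.chainMap' h.choose b.1)
        ((C.chain_compat h b).post _ f) :=
    (Category.assoc _ _ _).trans (congrArg (_ ≫ ·) (C.ψι_ψPush f (x := y) _))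
  refine (Category.assoc _ _ _).symm.trans ?_
  refine (congrArg (· ≫ C.ψPush f y) hl).trans (hc.trans ?_)
  refine (C.ψIncl_congr (y := Decomp.push f y) (b.push f) e _ _).trans (hr.symm.trans ?_)
  refine (congrArg (· ≫ (C.ψ W').map (homOfLE h')) (C.ψι_ψPush f b).symm).trans ?_
  exact Category.assoc _ _ _

/-- The statement typechecks because pushing `x` along the identity returns `x` definitionally;
likewise, in `ψPush_trans`, pushing along `f.trans g` is definitionally pushing twice. -/
lemma ψPush_refl (x : Decomp.{u} n W) :
    C.ψPush (Homeomorph.refl W) x = 𝟙 (C.ψObj W x) :=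
  C.ψ_hom_ext fun b => (C.ψι_ψPush _ b).trans (Category.comp_id _).symm

lemma ψPush_trans (f : W ≃ₜ W') (g : W' ≃ₜ W'') (x : Decomp.{u} n W) :
    C.ψPush (f.trans g) x = C.ψPush f x ≫ C.ψPush g (Decomp.push f x) := by
  refine C.ψ_hom_ext fun b => (C.ψι_ψPush _ b).trans ?_
  refine Eq.trans ?_ (Category.assoc (C.ψι b) (C.ψPush f x) (C.ψPush g (Decomp.push f x)))
  refine Eq.trans ?_ (congrArg (· ≫ C.ψPush g (Decomp.push f x)) (C.ψι_ψPush f b)).symm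
  exact (C.ψι_ψPush g (b.push f)).symm

/-! ### Passage to simplicial objects, bicomplexes and total complexes. -/

/-- The map `(x̄, a) ↦ (f ∘ x̄, a)` on the simplicial replacement of `ψ`. -/
def srepPush (f : W ≃ₜ W') : srep (C.ψ W) ⟶ srep (C.ψ W') :=
  srepMap (C.ψ W) (C.ψ W') (Decomp.push f) (C.ψPush f) (fun _ _ h => C.ψPush_naturality f h)

lemma srepPush_refl : C.srepPush (Homeomorph.refl W) = 𝟙 (srep (C.ψ W)) :=
  srepMap_eq_id (C.ψ W) _ _ C.ψPush_refl

lemma srepPush_trans (f : W ≃ₜ W') (g : W' ≃ₜ W'') :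
    C.srepPush (f.trans g) = C.srepPush f ≫ C.srepPush g :=
  srepMap_eq_comp (C.ψ W) (C.ψ W') (C.ψ W'') (Decomp.push f) (Decomp.push g)
    (C.ψPush f) (fun _ _ h => C.ψPush_naturality f h) (C.ψPush g)
    (fun _ _ h => C.ψPush_naturality g h) (γ := C.ψPush (f.trans g))
    (hγ := fun _ _ h => C.ψPush_naturality (f.trans g) h) (C.ψPush_trans f g)

/-- The blob complex as a bicomplex. -/
abbrev bicomplex (W : Type u) [TopologicalSpace W] :
    HomologicalComplex₂ (ModuleCat.{max v (u + 1) w} R) (ComplexShape.down ℕ)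
      (ComplexShape.down ℕ) :=
  HomologicalComplex₂.flip
    ((AlgebraicTopology.alternatingFaceMapComplex (BigCh.{u, w, v} R)).obj (srep (C.ψ W)))

def bicomplexPush (f : W ≃ₜ W') : C.bicomplex W ⟶ C.bicomplex W' :=
  (HomologicalComplex₂.flipFunctor _ _ _).map
    ((AlgebraicTopology.alternatingFaceMapComplex (BigCh.{u, w, v} R)).map (C.srepPush f))

/-- The chain map `(x̄, a) ↦ (f ∘ x̄, a)` of blob complexes. -/
def blobPush (f : W ≃ₜ W') : C.blob W ⟶ C.blob W' :=
  HomologicalComplex₂.total.map (C.bicomplexPush f) (ComplexShape.down ℕ)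

lemma blobPush_refl : C.blobPush (Homeomorph.refl W) = 𝟙 _ := by
  rw [blobPush, bicomplexPush, srepPush_refl, CategoryTheory.Functor.map_id,
    CategoryTheory.Functor.map_id]
  exact HomologicalComplex₂.total.map_id _ _

lemma blobPush_trans (f : W ≃ₜ W') (g : W' ≃ₜ W'') :
    C.blobPush (f.trans g) = C.blobPush f ≫ C.blobPush g := by
  rw [blobPush, bicomplexPush, srepPush_trans, CategoryTheory.Functor.map_comp,
    CategoryTheory.Functor.map_comp]
  exact HomologicalComplex₂.total.map_comp _ _ _

/-- This ties the abstractly induced map to the formula `(x̄, a) ↦ (f ∘ x̄, a)`. After the flip, the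
first index of the bicomplex is the internal degree `q` of `a` and the second is the simplicial
degree `m`; the induced map preserves both, so no sign appears. -/
lemma gen_blobPush (f : W ≃ₜ W') {m : ℕ} (s : Simplex (Decomp.{u} n W) m) (b : C.Bdl (s 0))
    (q : ℕ) : C.gen s b q ≫ (C.blobPush f).f (q + m) =
      C.gen ((Decomp.push f).comp s) (b.push f) q := by
  have h : (C.ψι b ≫ srepι (C.ψ W) s) ≫
      (C.srepPush f).app (Opposite.op (SimplexCategory.mk m)) =
      C.ψPushι f b ≫ srepι (C.ψ W') ((Decomp.push f).comp s) := by
    refine (Category.assoc _ _ _).trans ((congrArg (C.ψι b ≫ ·) (srepι_srepMap (C.ψ W) (C.ψ W') (Decomp.push f)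
      (C.ψPush f) (fun _ _ h => C.ψPush_naturality f h) s)).trans ?_)
    refine (Category.assoc _ _ _).symm.trans ?_
    exact congrArg (· ≫ _) (C.ψι_ψPush f b)
  have h' := congrArg (fun φ => φ.f q) h
  refine (Category.assoc _ _ _).trans ?_
  refine (congrArg (_ ≫ ·) (HomologicalComplex₂.ιTotal_map (C.bicomplex W) (C.bicomplex W')
    (C.bicomplexPush f) (ComplexShape.down ℕ) q m (q + m) rfl)).trans ?_
  refine (Category.assoc _ _ _).symm.trans ?_
  exact congrArg (· ≫ _) h'

/-! ### The functor to isomorphisms and the group action. -/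

/-- The isomorphism of blob complexes induced by a homeomorphism. -/
def blobIso (f : W ≃ₜ W') : C.blob W ≅ C.blob W' where
  hom := C.blobPush f
  inv := C.blobPush f.symm
  hom_inv_id := by rw [← blobPush_trans, Homeomorph.self_trans_symm, blobPush_refl]
  inv_hom_id := by rw [← blobPush_trans, Homeomorph.symm_trans_self, blobPush_refl]

/-- The blob complex as a functor on manifolds and homeomorphisms. -/
def blobFunctor : Mfd.{u} n ⥤ Core (BigCh.{u, w, v} R) where
  obj W := ⟨C.blob W⟩
  map {W W'} f := ⟨C.blobIso (W := W) (W' := W') f⟩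
  map_id W := CoreHom.ext (Iso.ext (C.blobPush_refl (W := W)))
  map_comp {W W' W''} f g :=
    CoreHom.ext (Iso.ext (C.blobPush_trans (W := W) (W' := W') (W'' := W'') f g))

/-- The action of the group of homeomorphisms of `W` on the blob complex. -/
def homeoAction (W : Type u) [TopologicalSpace W] : (W ≃ₜ W) →* Aut (C.blob W) where
  toFun f := C.blobIso f
  map_one' := Iso.ext C.blobPush_refl
  -- The order is reversed on both sides: `f * g` is `g.trans f` in the group of homeomorphisms, and
  -- multiplication in `Aut` also applies the right factor before the left one. The result is
  -- therefore a left action.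
  map_mul' f g := Iso.ext (C.blobPush_trans g f)

end PreNCategory

end Blob

theorem mainTheorem12 {R : Type v} [CommRing R] (n : ℕ) (C : Blob.PreNCategory.{u, w} n R) :
    ∃ F : Blob.Mfd.{u} n ⥤ Core (Blob.BigCh.{u, w, v} R),
      ∃ hF : ∀ W, (F.obj W).of = C.blob W,
        (∀ (W W' : Blob.Mfd.{u} n) (f : W ≃ₜ W') (m : ℕ) (s : Blob.Simplex (Blob.Decomp n W) m)
          (b : C.Bdl (s 0)) (q : ℕ),
          C.gen s b q ≫
            (eqToHom (hF W).symm ≫ (F.map (X := W) (Y := W') f).iso.hom ≫ eqToHom (hF W')).f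
              (q + m) =
            C.gen ((Blob.Decomp.push f).comp s) (b.push f) q) ∧
        ∀ W : Blob.Mfd.{u} n, ∃ ρ : (W ≃ₜ W) →* Aut (C.blob W), ∀ f : W ≃ₜ W,
          (ρ f).hom =
            eqToHom (hF W).symm ≫ (F.map (X := W) (Y := W) f).iso.hom ≫ eqToHom (hF W) := by
  refine ⟨C.blobFunctor, fun _ => rfl, fun W W' f m s b q => ?_,
    fun W => ⟨C.homeoAction W, fun f => ?_⟩⟩
  -- Since `hF` is proved by `rfl`, both `eqToHom` factors unfold to identities.
  · have h : 𝟙 (C.blob W) ≫ C.blobPush f ≫ 𝟙 (C.blob W') = C.blobPush f :=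
      (Category.id_comp _).trans (Category.comp_id _)
    exact (congrArg (fun φ : C.blob W ⟶ C.blob W' => C.gen s b q ≫ φ.f (q + m)) h).trans
      (C.gen_blobPush f s b q)
  · exact ((Category.id_comp _).trans (Category.comp_id (C.blobPush f))).symm
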